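/- Let $(W,S)$ be an irreducible Coxeter system with $S$ finite, that is, its Coxeter diagram is connected. Assume that $W$ is infinite and non-affine, and that the Coxeter diagram is simply laced, i.e. $m(s,s')\in\{2,3\}$ for all $s\neq s'$ in $S$, where $m(s,s')$ is the order of $ss'$. Here $W$ is called affine if the symmetric bilinear form on $\mathbb{R}^S$ given on the standard basis by $(\alpha_s,\alpha_{s'})=-\cos(\pi/m(s,s'))$ (read as $-1$ when $m(s,s')=\infty$) is positive semidefinite but not positive definite. Let $\ell$ be the length function of $W$ with respect to $S$, and let $T=\bigcup_{w\in W}wSw^{-1}$ be the set of reflections. Let $J\subsetneq S$ be such that the parabolic subgroup $W_J=\langle J\rangle$ is infinite. Then there is a natural number $M$ such that for every integer $k\ge 0$ there are at least $2^k$ elements $t\in T\setminus W_J$ with $\ell(t)\le M(2k+1)$. -/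

import Mathlib

namespace CoxeterMatrix

variable {B : Type*} (M : CoxeterMatrix B)

/-- The underlying graph of the Coxeter diagram: distinct nodes `i`, `j` are joined by an edge
when `m(i, j) ≠ 2`, that is `m(i, j) ≥ 3` or `m(i, j) = ∞` (which Mathlib encodes as `0`). -/
def diagram : SimpleGraph B where
  Adj i j := i ≠ j ∧ M i j ≠ 2
  symm := ⟨fun i j h => ⟨h.1.symm, by rw [M.symmetric]; exact h.2⟩⟩
  loopless := ⟨fun _ h => h.1 rfl⟩

/-- A Coxeter matrix is irreducible when its Coxeter diagram is connected. -/
def IsIrreducible : Prop := M.diagram.Connected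

/-- A Coxeter matrix is simply laced when all its off-diagonal entries are `2` or `3`. -/
def IsSimplyLaced : Prop := ∀ i j, i ≠ j → M i j = 2 ∨ M i j = 3

/-- The Gram matrix of the canonical bilinear form of the geometric representation, in the basis
of simple roots: `(α_i, α_j) = -cos (π / m(i, j))`, read as `-1` when `m(i, j) = ∞`. -/
noncomputable def gram : Matrix B B ℝ :=
  Matrix.of fun i j => if M i j = 0 then -1 else -Real.cos (Real.pi / M i j)

/-- An irreducible Coxeter matrix is affine when its canonical bilinear form is positive
semidefinite but not positive definite. -/
def IsAffine : Prop := M.IsIrreducible ∧ M.gram.PosSemidef ∧ ¬ M.gram.PosDef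

end CoxeterMatrix

namespace CoxeterSystem

variable {B W : Type*} [Group W] {M : CoxeterMatrix B} (cs : CoxeterSystem M W)

/-- The standard parabolic subgroup `W_J`, generated by the simple reflections indexed by `J`. -/
def parabolic (J : Set B) : Subgroup W := Subgroup.closure (cs.simple '' J)

end CoxeterSystem

/-! Work in the root lattice `B → ℤ` with twice the canonical form; simple lacing makes it integral,
and roots have norm 2. If no two positive roots pair to at most `-2`, the pairings of a root with
the simple roots lie in `[-2, 2]` and determine it; there are then finitely many roots, and by
faithfulness the group is finite. Hence an infinite `W_J` yields positive roots `x`, `y` supported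
in `J` with `(x, y) ≤ -2` (`exists_isRoot_pair_of_infinite_parabolic`). For `s ∉ J`, connectedness
gives a positive root `c` with `c s > 0` and `(c, x + y) < 0` (`exists_isRoot_rootForm_neg`). Two
applications of `IsRoot.exists_pair_lt` make `c`, `x`, `y` pair mutually to at most `-2`. Ping-pong
with their reflections follows: each conjugation has two admissible letters, different choices give
different reflections, and all their roots have positive `s`-coordinate, which keeps them out of
`W_J`. -/

namespace CoxeterMatrix

/-! ### The integral root form and its reflections. -/

section RootForm

variable {B : Type*} (M : CoxeterMatrix B)

/-- The generalized Cartan matrix of a simply laced Coxeter matrix. -/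
def cartan : Matrix B B ℤ :=
  Matrix.of fun i j => if M i j = 1 then 2 else if M i j = 3 then -1 else 0

theorem cartan_symm (i j : B) : M.cartan i j = M.cartan j i := by
  simp [cartan, M.symmetric i j]

theorem cartan_nonpos {i j : B} (h : i ≠ j) : M.cartan i j ≤ 0 := by
  have := M.off_diagonal i j h
  simp only [cartan, Matrix.of_apply, this, if_false]
  split_ifs <;> norm_num

theorem mul_cartan_nonpos {x y : B → ℤ} (hx : 0 ≤ x) (hy : 0 ≤ y)
    (hxy : ∀ i, x i = 0 ∨ y i = 0) (i j : B) : x i * y j * M.cartan i j ≤ 0 := by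
  by_cases h : i = j
  · subst h
    rcases hxy i with h | h <;> simp [h]
  · exact mul_nonpos_of_nonneg_of_nonpos (mul_nonneg (hx i) (hy j)) (M.cartan_nonpos h)

variable [Fintype B] [DecidableEq B]

/-- The integral bilinear form on the root lattice of a simply laced Coxeter matrix. -/
def rootForm : (B → ℤ) →ₗ[ℤ] (B → ℤ) →ₗ[ℤ] ℤ := Matrix.toLinearMap₂' ℤ M.cartan

/-- The reflection in the vector `v`, assuming that `v` has norm `2`. -/
def refl (v : B → ℤ) : Module.End ℤ (B → ℤ) :=
  LinearMap.id - (M.rootForm.flip v).smulRight v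

theorem refl_apply (v x : B → ℤ) : M.refl v x = x - M.rootForm x v • v := by
  simp [refl]

theorem rootForm_apply (x y : B → ℤ) :
    M.rootForm x y = ∑ i, ∑ j, x i * y j * M.cartan i j := by
  simp [rootForm, Matrix.toLinearMap₂'_apply, mul_assoc]

theorem rootForm_single (i j : B) :
    M.rootForm (Pi.single i 1) (Pi.single j 1) = M.cartan i j := by
  simp [rootForm_apply, Pi.single_apply]

theorem rootForm_comm (x y : B → ℤ) : M.rootForm x y = M.rootForm y x := by
  rw [rootForm_apply, rootForm_apply, Finset.sum_comm]
  refine Finset.sum_congr rfl fun i _ => Finset.sum_congr rfl fun j _ => ?_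
  rw [M.cartan_symm i j]; ring

theorem rootForm_single_self (i : B) : M.rootForm (Pi.single i 1) (Pi.single i 1) = 2 := by
  simp [rootForm_single, cartan]

theorem rootForm_nonpos {x y : B → ℤ} (hx : 0 ≤ x) (hy : 0 ≤ y)
    (hxy : ∀ i, x i = 0 ∨ y i = 0) : M.rootForm x y ≤ 0 := by
  rw [rootForm_apply]
  exact Finset.sum_nonpos fun i _ => Finset.sum_nonpos fun j _ =>
    M.mul_cartan_nonpos hx hy hxy i j

theorem rootForm_neg {x y : B → ℤ} (hx : 0 ≤ x) (hy : 0 ≤ y)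
    (hxy : ∀ i, x i = 0 ∨ y i = 0) {i j : B} (hi : 0 < x i) (hj : 0 < y j) (hij : M i j = 3) :
    M.rootForm x y < 0 := by
  rw [rootForm_apply]
  refine Finset.sum_neg' (fun i _ => Finset.sum_nonpos fun j _ =>
    M.mul_cartan_nonpos hx hy hxy i j) ⟨i, Finset.mem_univ _, ?_⟩
  refine Finset.sum_neg' (fun j _ => M.mul_cartan_nonpos hx hy hxy i j)
    ⟨j, Finset.mem_univ _, ?_⟩
  have : M.cartan i j = -1 := by simp [cartan, hij]
  rw [this]
  nlinarith [mul_pos hi hj]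

theorem refl_self {v : B → ℤ} (hv : M.rootForm v v = 2) : M.refl v v = -v := by
  rw [refl_apply, hv]; module

theorem rootForm_refl {v : B → ℤ} (hv : M.rootForm v v = 2) (x y : B → ℤ) :
    M.rootForm (M.refl v x) (M.refl v y) = M.rootForm x y := by
  simp only [refl_apply, map_sub, map_smul, LinearMap.sub_apply, LinearMap.smul_apply,
    smul_eq_mul, hv, M.rootForm_comm v y]
  ring

theorem refl_mul_self {v : B → ℤ} (hv : M.rootForm v v = 2) : M.refl v * M.refl v = 1 := by
  refine LinearMap.ext fun x => ?_
  simp only [Module.End.mul_apply, Module.End.one_apply, refl_apply, map_sub, map_smul,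
    hv]
  module

theorem refl_single_isLiftable (hM : M.IsSimplyLaced) :
    M.IsLiftable fun i => M.refl (Pi.single i 1) := by
  intro i j
  by_cases hij : i = j
  · subst hij
    rw [M.diagonal, pow_one, M.refl_mul_self (M.rootForm_single_self i)]
  change (M.refl (Pi.single i 1) * M.refl (Pi.single j 1)) ^ M i j = 1
  have hi := M.rootForm_single_self i
  have hj := M.rootForm_single_self j
  have h1 := M.rootForm_single i j
  have h2 := M.rootForm_single j i
  generalize (Pi.single i 1 : B → ℤ) = a at *
  generalize (Pi.single j 1 : B → ℤ) = b at *
  rw [M.cartan_symm j i] at h2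
  rcases hM i j hij with h | h
  · have hc : M.cartan i j = 0 := by simp [cartan, h]
    rw [hc] at h1 h2
    rw [h]
    refine LinearMap.ext fun x => ?_
    simp only [pow_succ, pow_zero, one_mul, Module.End.mul_apply, Module.End.one_apply, refl_apply,
      map_sub, map_smul, hi, hj, h1, h2]
    module
  · have hc : M.cartan i j = -1 := by simp [cartan, h]
    rw [hc] at h1 h2
    rw [h]
    refine LinearMap.ext fun x => ?_
    simp only [pow_succ, pow_zero, one_mul, Module.End.mul_apply, Module.End.one_apply, refl_apply,
      map_sub, map_smul, hi, hj, h1, h2]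
    module

end RootForm

/-- The Coxeter matrix obtained by restricting to a subset of the nodes. -/
def restrict {B : Type*} (M : CoxeterMatrix B) (J : Set B) : CoxeterMatrix J where
  M := Matrix.of fun i j => M i j
  isSymm := Matrix.IsSymm.ext fun i j => M.symmetric j i
  diagonal i := M.diagonal i
  off_diagonal i j h := M.off_diagonal i j (fun h' => h (Subtype.ext h'))

end CoxeterMatrix

namespace CoxeterSystem

/-! ### Roots, positivity and faithfulness. -/

section GeometricRepresentation

variable {B W : Type*} [Fintype B] [DecidableEq B] [Group W] {M : CoxeterMatrix B}
  (cs : CoxeterSystem M W) (hM : M.IsSimplyLaced)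

/-- The integral geometric representation of a simply laced Coxeter group. -/
noncomputable def geomRep : W →* Module.End ℤ (B → ℤ) :=
  cs.lift ⟨fun i => M.refl (Pi.single i 1), M.refl_single_isLiftable hM⟩

theorem geomRep_simple (i : B) : cs.geomRep hM (cs.simple i) = M.refl (Pi.single i 1) :=
  cs.lift_apply_simple _ i

theorem rootForm_geomRep (w : W) (x y : B → ℤ) :
    M.rootForm (cs.geomRep hM w x) (cs.geomRep hM w y) = M.rootForm x y := by
  induction w using cs.simple_induction_left with
  | one => simp
  | mul_simple_left w i ih =>
    rw [map_mul, geomRep_simple, Module.End.mul_apply, Module.End.mul_apply,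
      M.rootForm_refl (M.rootForm_single_self i), ih]

theorem geomRep_inv_apply (w : W) (x : B → ℤ) :
    cs.geomRep hM w⁻¹ (cs.geomRep hM w x) = x := by
  rw [← Module.End.mul_apply, ← map_mul, inv_mul_cancel, map_one, Module.End.one_apply]

theorem geomRep_apply_inv (w : W) (x : B → ℤ) :
    cs.geomRep hM w (cs.geomRep hM w⁻¹ x) = x := by
  rw [← Module.End.mul_apply, ← map_mul, mul_inv_cancel, map_one, Module.End.one_apply]

theorem rootForm_geomRep_left (w : W) (x y : B → ℤ) :
    M.rootForm (cs.geomRep hM w x) y = M.rootForm x (cs.geomRep hM w⁻¹ y) := by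
  rw [← cs.rootForm_geomRep hM w⁻¹ (cs.geomRep hM w x) y, geomRep_inv_apply]

/-- The (real) roots: the orbit of the simple roots. -/
def IsRoot (v : B → ℤ) : Prop := ∃ w i, cs.geomRep hM w (Pi.single i 1) = v

theorem isRoot_single (i : B) : cs.IsRoot hM (Pi.single i 1) := ⟨1, i, by simp⟩

variable {cs hM}

theorem IsRoot.geomRep {v : B → ℤ} (hv : cs.IsRoot hM v) (w : W) :
    cs.IsRoot hM (cs.geomRep hM w v) := by
  obtain ⟨u, i, rfl⟩ := hv
  exact ⟨w * u, i, by rw [map_mul, Module.End.mul_apply]⟩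

theorem IsRoot.rootForm_self {v : B → ℤ} (hv : cs.IsRoot hM v) : M.rootForm v v = 2 := by
  obtain ⟨u, i, rfl⟩ := hv
  rw [rootForm_geomRep, M.rootForm_single_self]

theorem geomRep_conj {t : W} {v : B → ℤ} (ht : cs.geomRep hM t = M.refl v) (w : W) :
    cs.geomRep hM (w * t * w⁻¹) = M.refl (cs.geomRep hM w v) := by
  refine LinearMap.ext fun x => ?_
  rw [map_mul, map_mul, ht, Module.End.mul_apply, Module.End.mul_apply, M.refl_apply, M.refl_apply,
    map_sub, map_smul, geomRep_apply_inv, rootForm_geomRep_left, inv_inv]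

theorem IsRoot.exists_isReflection {v : B → ℤ} (hv : cs.IsRoot hM v) :
    ∃ t, cs.IsReflection t ∧ cs.geomRep hM t = M.refl v := by
  obtain ⟨u, i, rfl⟩ := hv
  exact ⟨_, ⟨u, i, rfl⟩, geomRep_conj (cs.geomRep_simple hM i) u⟩

theorem IsRoot.refl {v x : B → ℤ} (hx : cs.IsRoot hM x) (hv : cs.IsRoot hM v) :
    cs.IsRoot hM (M.refl v x) := by
  obtain ⟨t, -, ht⟩ := hv.exists_isReflection
  exact ht ▸ hx.geomRep t

theorem IsRoot.neg {v : B → ℤ} (hv : cs.IsRoot hM v) : cs.IsRoot hM (-v) :=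
  M.refl_self hv.rootForm_self ▸ hv.refl hv

variable (cs hM)

theorem geomRep_mul_simple (w : W) (i : B) (x : B → ℤ) :
    cs.geomRep hM (w * cs.simple i) x =
      cs.geomRep hM w x - M.rootForm x (Pi.single i 1) • cs.geomRep hM w (Pi.single i 1) := by
  rw [map_mul, Module.End.mul_apply, geomRep_simple, M.refl_apply, map_sub, map_smul]

/-- Induction on length: strip a right descent `j` from `w` and compute in the rank-two group of `i`
and `j`, where `m` is 2 or 3. -/
theorem geomRep_single_nonneg (w : W) (i : B) (h : cs.length w < cs.length (w * cs.simple i)) :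
    0 ≤ cs.geomRep hM w (Pi.single i 1) := by
  induction hn : cs.length w using Nat.strong_induction_on generalizing w i with
  | _ n IH =>
  subst hn
  by_cases hw : w = 1
  · subst hw
    simp
  obtain ⟨j, hj⟩ := cs.exists_rightDescent_of_ne_one hw
  have hij : i ≠ j := by
    rintro rfl
    exact absurd hj (not_lt_of_gt h)
  obtain ⟨u, rfl⟩ : ∃ u, w = u * cs.simple j := ⟨w * cs.simple j, by simp⟩
  rw [IsRightDescent, simple_mul_simple_cancel_right] at hj
  have hu := cs.length_mul_simple u j
  have huj : 0 ≤ cs.geomRep hM u (Pi.single j 1) := IH _ hj u j hj rfl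
  rw [geomRep_mul_simple, M.rootForm_single]
  rcases hM i j hij with h2 | h3
  · have hc : M.cartan i j = 0 := by simp [CoxeterMatrix.cartan, h2]
    rw [hc, zero_smul, sub_zero]
    refine IH _ hj u i ?_ rfl
    by_contra hlt
    have hcomm : u * cs.simple j * cs.simple i = u * cs.simple i * cs.simple j := by
      have := cs.simple_mul_simple_pow' i j
      rw [h2, pow_two] at this
      have h' : cs.simple j * cs.simple i = cs.simple i * cs.simple j := by
        rw [← mul_inv_eq_one, mul_inv_rev, inv_simple, inv_simple]
        exact this
      rw [mul_assoc, h', mul_assoc]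
    rw [hcomm] at h
    have h1 := cs.length_mul_simple u i
    have h2 := cs.length_mul_simple (u * cs.simple i) j
    omega
  · have hc : M.cartan i j = -1 := by simp [CoxeterMatrix.cartan, h3]
    rw [hc, neg_one_smul, sub_neg_eq_add]
    rcases cs.length_mul_simple u i with hui | hui
    · exact add_nonneg (IH _ hj u i (by omega) rfl) huj
    -- Here `w = v s_i s_j`, and `s_i s_j` sends `α_i` to `α_j`, so the vector is `v α_j`; the braid
    -- relation shows that `j` is an ascent of `v`.
    · obtain ⟨v, rfl⟩ : ∃ v, u = v * cs.simple i := ⟨u * cs.simple i, by simp⟩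
      have hbraid : v * cs.simple i * cs.simple j * cs.simple i =
          v * cs.simple j * cs.simple i * cs.simple j := by
        have := cs.simple_mul_simple_pow i j
        rw [h3, pow_succ, pow_two] at this
        have h' : cs.simple i * cs.simple j * cs.simple i =
            cs.simple j * cs.simple i * cs.simple j := by
          rw [← mul_inv_eq_one]
          simpa [mul_assoc] using this
        calc _ = v * (cs.simple i * cs.simple j * cs.simple i) := by group
          _ = _ := by rw [h']; group
      rw [simple_mul_simple_cancel_right] at hui
      rw [hbraid] at h
      have hvj : cs.length v < cs.length (v * cs.simple j) := by
        have h1 := cs.length_mul_simple v j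
        have h2 := cs.length_mul_simple (v * cs.simple j) i
        have h3 := cs.length_mul_simple (v * cs.simple j * cs.simple i) j
        omega
      have := IH _ (by omega) v j hvj rfl
      rw [geomRep_mul_simple, geomRep_mul_simple, M.rootForm_single j i, M.rootForm_single_self,
        M.cartan_symm j i, hc]
      convert this using 1
      module

variable {cs hM}

theorem IsRoot.nonneg_or_nonneg_neg {v : B → ℤ} (hv : cs.IsRoot hM v) : 0 ≤ v ∨ 0 ≤ -v := by
  obtain ⟨w, i, rfl⟩ := hv
  rcases cs.length_mul_simple w i with h | h
  · exact Or.inl (cs.geomRep_single_nonneg hM w i (by omega))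
  · right
    have := cs.geomRep_single_nonneg hM (w * cs.simple i) i
      (by rw [simple_mul_simple_cancel_right]; omega)
    rw [geomRep_mul_simple, M.rootForm_single_self] at this
    convert this using 1
    module

variable (cs hM)

theorem geomRep_injective : Function.Injective (cs.geomRep hM) := by
  have key : ∀ w, cs.geomRep hM w = 1 → w = 1 := by
    intro w hw
    by_contra hne
    obtain ⟨i, hi⟩ := cs.exists_rightDescent_of_ne_one hne
    have := cs.geomRep_single_nonneg hM (w * cs.simple i) i
      (by rw [simple_mul_simple_cancel_right]; exact hi)
    rw [geomRep_mul_simple, M.rootForm_single_self, hw] at this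
    have h := this i
    simp at h
  intro w u h
  rw [← mul_inv_eq_one]
  apply key
  rw [map_mul, h, ← map_mul, mul_inv_cancel, map_one]

variable {cs hM}

/-- If no two positive roots pair to at most `-2`, then a root pairing to at least `2` with a
simple root equals it. -/
theorem IsRoot.eq_single_of_two_le
    (hneg : ∀ x y, cs.IsRoot hM x → cs.IsRoot hM y → 0 ≤ x → 0 ≤ y → -2 < M.rootForm x y)
    {v : B → ℤ} (hv : cs.IsRoot hM v) {i : B} (h : 2 ≤ M.rootForm v (Pi.single i 1)) :
    v = Pi.single i 1 := by
  have hs := cs.isRoot_single hM i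
  have hs0 : (0 : B → ℤ) ≤ Pi.single i 1 := by simp
  rcases hv.nonneg_or_nonneg_neg with h0 | h0
  · have hr := hv.refl hs
    have hform : M.rootForm (M.refl (Pi.single i 1) v) (Pi.single i 1) =
        - M.rootForm v (Pi.single i 1) := by
      rw [M.refl_apply, map_sub, map_smul, LinearMap.sub_apply, LinearMap.smul_apply,
        M.rootForm_single_self, smul_eq_mul]
      ring
    rcases hr.nonneg_or_nonneg_neg with h1 | h1
    · have := hneg _ _ hr hs h1 hs0
      omega
    -- The reflection changes only the `i`-coordinate, so a positive root made negative by it is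
    -- supported at `i`.
    · have hvi : v = v i • Pi.single i 1 := by
        ext j
        by_cases hj : j = i
        · subst hj; simp
        · have h2 := h1 j
          rw [M.refl_apply] at h2
          have h3 := h0 j
          simp [hj] at h2 h3 ⊢
          omega
      have h2 := hv.rootForm_self
      rw [hvi, map_smul, map_smul, LinearMap.smul_apply, M.rootForm_single_self] at h2
      simp only [smul_eq_mul] at h2
      have h3 : v i = 1 := by
        have : 0 ≤ v i := h0 i
        nlinarith
      rw [hvi, h3, one_smul]
  · have := hneg _ _ hv.neg hs h0 hs0
    rw [map_neg, LinearMap.neg_apply] at this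
    omega

/-- Otherwise roots inject into a finite box of pairings with simple roots, and `W` acts faithfully
on finitely many roots. -/
theorem exists_isRoot_pair [Infinite W] (cs : CoxeterSystem M W) (hM : M.IsSimplyLaced) :
    ∃ x y, cs.IsRoot hM x ∧ cs.IsRoot hM y ∧ 0 ≤ x ∧ 0 ≤ y ∧ M.rootForm x y ≤ -2 := by
  by_contra! hneg
  have hle : ∀ v, cs.IsRoot hM v → ∀ i, M.rootForm v (Pi.single i 1) ≤ 2 := by
    intro v hv i
    by_contra! h
    have := hv.eq_single_of_two_le hneg h.le
    rw [this, M.rootForm_single_self] at h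
    omega
  have hinj : ∀ u v, cs.IsRoot hM u → cs.IsRoot hM v → M.rootForm u v = 2 → u = v := by
    rintro u v hu ⟨w, i, rfl⟩ h
    rw [M.rootForm_comm, rootForm_geomRep_left, M.rootForm_comm] at h
    rw [← (hu.geomRep w⁻¹).eq_single_of_two_le hneg h.ge, geomRep_apply_inv]
  have hfin : Finite {v // cs.IsRoot hM v} := by
    have hmem : ∀ v : {v // cs.IsRoot hM v}, ∀ i,
        M.rootForm v.1 (Pi.single i 1) ∈ Set.Icc (-2 : ℤ) 2 := by
      intro v i
      have := hle _ v.2.neg i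
      rw [map_neg, LinearMap.neg_apply] at this
      exact ⟨by omega, hle _ v.2 i⟩
    refine Finite.of_injective
      (fun v => fun i => (⟨_, hmem v i⟩ : Set.Icc (-2 : ℤ) 2)) fun u v huv => ?_
    have heq : M.rootForm u.1 = M.rootForm v.1 := by
      refine LinearMap.pi_ext' fun i => LinearMap.ext_ring ?_
      simpa using congrArg Subtype.val (congrFun huv i)
    exact Subtype.ext (hinj _ _ u.2 v.2 (by rw [heq, v.2.rootForm_self]))
  have hWfin : Finite W := by
    refine Finite.of_injective (fun w => fun i =>
      (⟨_, (cs.isRoot_single hM i).geomRep w⟩ : {v // cs.IsRoot hM v})) fun w u h => ?_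
    apply cs.geomRep_injective hM
    refine LinearMap.pi_ext' fun i => LinearMap.ext_ring ?_
    simpa using congrArg Subtype.val (congrFun h i)
  exact not_finite W

end GeometricRepresentation

/-! ### Root pairs from parabolic subgroups, and the connecting root. -/

section Parabolic

variable {B W : Type*} [Fintype B] [DecidableEq B] [Group W] {M : CoxeterMatrix B}
  (cs : CoxeterSystem M W) (hM : M.IsSimplyLaced)

theorem geomRep_apply_of_mem_parabolic {J : Set B} {w : W} (hw : w ∈ cs.parabolic J)
    {i : B} (hi : i ∉ J) (x : B → ℤ) : cs.geomRep hM w x i = x i := by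
  induction hw using Subgroup.closure_induction generalizing x with
  | mem w hw =>
    obtain ⟨j, hj, rfl⟩ := hw
    have : i ≠ j := fun h => hi (h ▸ hj)
    simp [geomRep_simple, M.refl_apply, this]
  | one => simp
  | mul u v _ _ hu hv => rw [map_mul, Module.End.mul_apply, hu, hv]
  | inv u _ hu => rw [← hu (cs.geomRep hM u⁻¹ x), geomRep_apply_inv]

/-- An infinite parabolic subgroup has two positive roots pairing to at most `-2`. -/
theorem exists_isRoot_pair_of_infinite_parabolic {J : Set B} (hJ : Infinite (cs.parabolic J)) :
    ∃ x y, cs.IsRoot hM x ∧ cs.IsRoot hM y ∧ 0 ≤ x ∧ 0 ≤ y ∧ M.rootForm x y ≤ -2 ∧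
      ∀ i ∉ J, x i = 0 ∧ y i = 0 := by
  classical
  -- Only the infinitude of the abstract Coxeter group on `J` is needed, so a map from it whose
  -- range contains `W_J` suffices.
  let M' := M.restrict J
  let cs' := M'.toCoxeterSystem
  have hM' : M'.IsSimplyLaced := fun i j h => hM i j (fun h' => h (Subtype.ext h'))
  have hlift : M'.IsLiftable fun j : J => cs.simple j := fun i j => cs.simple_mul_simple_pow i j
  let φ : M'.Group →* W := cs'.lift ⟨_, hlift⟩
  have hφ (j : J) : φ (cs'.simple j) = cs.simple j := cs'.lift_apply_simple hlift j
  have hrange : cs.parabolic J ≤ φ.range := by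
    rw [parabolic, Subgroup.closure_le]
    rintro _ ⟨j, hj, rfl⟩
    exact ⟨_, hφ ⟨j, hj⟩⟩
  have : Infinite M'.Group := by
    have : Infinite φ.range := Infinite.of_injective _ (Subgroup.inclusion_injective hrange)
    exact Infinite.of_surjective _ φ.rangeRestrict_surjective
  let e : (J → ℤ) →ₗ[ℤ] (B → ℤ) :=
    Fintype.linearCombination ℤ fun j : J => (Pi.single (j : B) 1 : B → ℤ)
  have he (j : J) : e (Pi.single j 1) = Pi.single (j : B) 1 := by
    simp [e, Fintype.linearCombination_apply_single]
  have he_apply (x : J → ℤ) (i : B) : e x i = ∑ j, x j * (Pi.single (j : B) 1 : B → ℤ) i := by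
    simp [e, Fintype.linearCombination_apply]
  have hnonneg (x : J → ℤ) (hx : 0 ≤ x) : 0 ≤ e x := by
    intro i
    rw [he_apply]
    refine Finset.sum_nonneg fun j _ => mul_nonneg (hx j) ?_
    rw [Pi.single_apply]
    split_ifs <;> norm_num
  have hzero (x : J → ℤ) (i : B) (hi : i ∉ J) : e x i = 0 := by
    rw [he_apply]
    refine Finset.sum_eq_zero fun j _ => ?_
    have : i ≠ j := fun h => hi (h ▸ j.2)
    simp [this]
  have hform (x y : J → ℤ) : M.rootForm (e x) (e y) = M'.rootForm x y := by
    have : M.rootForm.compl₁₂ e e = M'.rootForm := by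
      refine LinearMap.pi_ext' fun i => LinearMap.ext_ring (LinearMap.pi_ext' fun j =>
        LinearMap.ext_ring ?_)
      simp only [LinearMap.comp_apply, LinearMap.single_apply, LinearMap.compl₁₂_apply, he,
        CoxeterMatrix.rootForm_single]
      rfl
    rw [← this, LinearMap.compl₁₂_apply]
  have hrep (w : M'.Group) (x : J → ℤ) :
      cs.geomRep hM (φ w) (e x) = e (cs'.geomRep hM' w x) := by
    induction w using cs'.simple_induction_left with
    | one => simp
    | mul_simple_left w i ih =>
      simp only [map_mul, Module.End.mul_apply, ih, hφ, geomRep_simple, M.refl_apply,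
        M'.refl_apply, map_sub, map_smul]
      rw [← he, hform]
  have hroot (x : J → ℤ) (hx : cs'.IsRoot hM' x) : cs.IsRoot hM (e x) := by
    obtain ⟨w, i, rfl⟩ := hx
    exact ⟨φ w, i, by rw [← he, hrep]⟩
  obtain ⟨x, y, hx, hy, hx0, hy0, hxy⟩ := exists_isRoot_pair cs' hM'
  exact ⟨e x, e y, hroot x hx, hroot y hy, hnonneg x hx0, hnonneg y hy0, by rwa [hform],
    fun i hi => ⟨hzero x i hi, hzero y i hi⟩⟩

/-- In a connected diagram, a node outside the support of `z` lies in the support of a positive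
root that pairs negatively with `z` and whose support is disjoint from that of `z`. -/
theorem exists_isRoot_rootForm_neg {z : B → ℤ} (hz : 0 ≤ z) {u v : B}
    (p : M.diagram.Walk v u) (hu : 0 < z u) (hv : z v = 0) :
    ∃ c, cs.IsRoot hM c ∧ 0 ≤ c ∧ (∀ i, c i = 0 ∨ z i = 0) ∧ M.rootForm c z < 0 ∧ 0 < c v := by
  induction p with
  | nil => omega
  | @cons v b u hadj p ih =>
    have hvb : M v b = 3 := (hM v b hadj.1).resolve_left hadj.2
    have hs0 : (0 : B → ℤ) ≤ Pi.single v 1 := by simp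
    have hdisj : ∀ i, (Pi.single v 1 : B → ℤ) i = 0 ∨ z i = 0 := by
      intro i
      by_cases h : i = v
      · exact Or.inr (h ▸ hv)
      · exact Or.inl (by simp [h])
    rcases (hz b).lt_or_eq with hb | hb
    · exact ⟨Pi.single v 1, cs.isRoot_single hM v, hs0, hdisj,
        M.rootForm_neg hs0 hz hdisj (i := v) (by simp) hb hvb, by simp⟩
    obtain ⟨c, hc, hc0, hcz, hneg, hcb⟩ := ih hu hb.symm
    rcases (hc0 v).lt_or_eq with hcv | hcv
    · exact ⟨c, hc, hc0, hcz, hneg, hcv⟩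
    have hcs : M.rootForm c (Pi.single v 1) < 0 := by
      refine M.rootForm_neg hc0 hs0 (fun i => ?_) hcb (j := v) (by simp)
        (by rw [M.symmetric, hvb])
      by_cases h : i = v
      · exact Or.inl (h ▸ hcv.symm)
      · exact Or.inr (by simp [h])
    -- Since `(c, α_v) < 0`, reflecting adds a positive multiple of `α_v` to `c`.
    refine ⟨M.refl (Pi.single v 1) c, hc.refl (cs.isRoot_single hM v), ?_, ?_, ?_, ?_⟩
    · rw [M.refl_apply, sub_eq_add_neg, ← neg_smul]
      exact add_nonneg hc0 (smul_nonneg (by omega) hs0)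
    · intro i
      by_cases h : i = v
      · exact Or.inr (h ▸ hv)
      · simpa [M.refl_apply, h] using hcz i
    · rw [M.refl_apply, map_sub, map_smul, LinearMap.sub_apply, LinearMap.smul_apply, smul_eq_mul]
      nlinarith [M.rootForm_nonpos hs0 hz hdisj]
    · have : c v = 0 := hcv.symm
      simp only [M.refl_apply, Pi.sub_apply, Pi.smul_apply, Pi.single_eq_same, smul_eq_mul]
      omega

end Parabolic

/-! ### Ping-pong on three reflections. -/

section PingPong

variable {B W : Type*} [Fintype B] [DecidableEq B] [Group W] {M : CoxeterMatrix B}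
  {cs : CoxeterSystem M W} {hM : M.IsSimplyLaced}

/-- Passing from `x, y` to the images `t_y x`, `t_x y` keeps the pairing at most `-2`, and makes the
pairings with `c` more negative. -/
theorem IsRoot.exists_pair_lt {c x y : B → ℤ} {n : ℤ} (hn : 0 ≤ n) (hx : cs.IsRoot hM x)
    (hy : cs.IsRoot hM y) (hxy : M.rootForm x y ≤ -2) (hcx : M.rootForm c x ≤ -n)
    (hcy : M.rootForm c y ≤ -n) (hc : M.rootForm c x + M.rootForm c y < 0) {i : B}
    (hxi : x i = 0) (hyi : y i = 0) :
    ∃ x' y', cs.IsRoot hM x' ∧ cs.IsRoot hM y' ∧ M.rootForm x' y' ≤ -2 ∧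
      M.rootForm c x' < -n ∧ M.rootForm c y' < -n ∧ x' i = 0 ∧ y' i = 0 := by
  refine ⟨M.refl y x, M.refl x y, hx.refl hy, hy.refl hx, ?_, ?_, ?_, ?_, ?_⟩
  · simp only [M.refl_apply, map_sub, map_smul, LinearMap.sub_apply, LinearMap.smul_apply,
      smul_eq_mul, hx.rootForm_self, hy.rootForm_self, M.rootForm_comm y x]
    -- The new pairing is `a³ - 3a`, and `a³ - 3a + 2 = (a - 1)²(a + 2)`.
    generalize M.rootForm x y = a at *
    nlinarith [mul_nonneg (sq_nonneg (a - 1)) (by linarith : 0 ≤ -a - 2)]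
  · simp only [M.refl_apply, map_sub, map_smul, smul_eq_mul]
    nlinarith
  · simp only [M.refl_apply, map_sub, map_smul, smul_eq_mul, M.rootForm_comm y x]
    nlinarith
  · simp [M.refl_apply, hxi, hyi]
  · simp [M.refl_apply, hxi, hyi]

/-- The ping-pong invariant: `t` is the reflection in a root `v` with positive `s`-coordinate which
pairs positively with `b i` and at least as negatively with every other `b j`. -/
def IsPingPong (cs : CoxeterSystem M W) (hM : M.IsSimplyLaced) (b : Fin 3 → B → ℤ) (s : B)
    (i : Fin 3) (t : W) : Prop :=
  cs.IsReflection t ∧ ∃ v, cs.geomRep hM t = M.refl v ∧ M.rootForm v v = 2 ∧ 0 < v s ∧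
    0 < M.rootForm v (b i) ∧ ∀ j ≠ i, M.rootForm v (b j) ≤ -M.rootForm v (b i)

/-- Two roots of `t` are proportional, positively so by their `s`-coordinates, so their pairings
with `b i` have equal sign. -/
theorem IsPingPong.unique {b : Fin 3 → B → ℤ} {s : B} {i j : Fin 3} {t : W}
    (hi : IsPingPong cs hM b s i t) (hj : IsPingPong cs hM b s j t) : i = j := by
  obtain ⟨-, v, hv, hv2, hvs, hvi, hvj⟩ := hi
  obtain ⟨-, u, hu, hu2, hus, huj, hui⟩ := hj
  by_contra hne
  have heq : -v = v - M.rootForm v u • u := by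
    rw [← M.refl_self hv2, ← hv, hu, M.refl_apply]
  have hs := congrFun heq s
  simp only [Pi.neg_apply, Pi.sub_apply, Pi.smul_apply, smul_eq_mul] at hs
  have hpos : 0 < M.rootForm v u := by
    by_contra! h
    nlinarith
  have hb := congrArg (fun x => M.rootForm x (b i)) heq
  simp only [map_neg, map_sub, map_smul, LinearMap.sub_apply, LinearMap.smul_apply,
    LinearMap.neg_apply, smul_eq_mul] at hb
  have := hui i hne
  nlinarith

/-- Reflecting in `b j` negates `(v, b j) < 0` and adds at most `2 (v, b j)` to the other pairings,
which outweighs even `(v, b i) ≤ -(v, b j)`. -/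
theorem IsPingPong.conj {b : Fin 3 → B → ℤ} {s : B} {i j : Fin 3} {t r : W}
    (hb : ∀ i, M.rootForm (b i) (b i) = 2) (hbb : ∀ i j, i ≠ j → M.rootForm (b i) (b j) ≤ -2)
    (hbs : ∀ i, 0 ≤ b i s) (ht : IsPingPong cs hM b s i t) (hij : j ≠ i)
    (hr : cs.geomRep hM r = M.refl (b j)) : IsPingPong cs hM b s j (r * t * r⁻¹) := by
  obtain ⟨h, v, hv, hv2, hvs, hvi, hvj⟩ := ht
  have hj := hvj j hij
  have hform (l : Fin 3) : M.rootForm (M.refl (b j) v) (b l) =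
      M.rootForm v (b l) - M.rootForm v (b j) * M.rootForm (b j) (b l) := by
    simp only [M.refl_apply, map_sub, map_smul, LinearMap.sub_apply, LinearMap.smul_apply,
      smul_eq_mul]
  refine ⟨h.conj r, M.refl (b j) v, hr ▸ geomRep_conj hv r, ?_, ?_, ?_, ?_⟩
  · rw [M.rootForm_refl (hb j), hv2]
  · simp only [M.refl_apply, Pi.sub_apply, Pi.smul_apply, smul_eq_mul]
    nlinarith [hbs j]
  · rw [hform, hb]
    linarith
  · intro l hl
    rw [hform, hform, hb]
    have h1 := hbb j l hl.symm
    by_cases hli : l = i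
    · subst hli
      nlinarith
    · have := hvj l hli
      nlinarith

theorem exists_finset_isPingPong {b : Fin 3 → B → ℤ} {s : B} (hb : ∀ i, cs.IsRoot hM (b i))
    (hbb : ∀ i j, i ≠ j → M.rootForm (b i) (b j) ≤ -2) (hbs : ∀ i, 0 ≤ b i s) (h0 : 0 < b 0 s) :
    ∃ N : ℕ, ∀ k : ℕ, ∃ F : Finset (Fin 3 × W), F.card = 2 ^ k ∧
      ∀ q ∈ F, IsPingPong cs hM b s q.1 q.2 ∧ cs.length q.2 ≤ N * (2 * k + 1) := by
  classical
  choose r hr hrb using fun i => (hb i).exists_isReflection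
  let N := ∑ i, cs.length (r i)
  have hN (i : Fin 3) : cs.length (r i) ≤ N :=
    Finset.single_le_sum (f := fun i => cs.length (r i)) (fun _ _ => Nat.zero_le _)
      (Finset.mem_univ i)
  refine ⟨N, fun k => ?_⟩
  induction k with
  | zero =>
    refine ⟨{(0, r 0)}, by simp, fun q hq => ?_⟩
    rw [Finset.mem_singleton] at hq
    subst hq
    refine ⟨⟨hr 0, b 0, hrb 0, (hb 0).rootForm_self, h0, ?_, fun j hj => ?_⟩, by simpa using hN 0⟩
    · simp [(hb 0).rootForm_self]
    · simpa [(hb 0).rootForm_self] using hbb 0 j hj.symm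
  | succ k ih =>
    obtain ⟨F, hF, hFp⟩ := ih
    let next (q : (Fin 3 × W) × Bool) : Fin 3 := if q.2 then q.1.1 + 1 else q.1.1 + 2
    have hnext (q : (Fin 3 × W) × Bool) : next q ≠ q.1.1 := by
      obtain ⟨⟨i, t⟩, c⟩ := q
      cases c <;> fin_cases i <;> simp [next]
    let f (q : (Fin 3 × W) × Bool) : Fin 3 × W := (next q, r (next q) * q.1.2 * (r (next q))⁻¹)
    refine ⟨(F ×ˢ Finset.univ).image f, ?_, ?_⟩
    · rw [Finset.card_image_of_injOn, Finset.card_product, hF, Finset.card_univ, Fintype.card_bool,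
        pow_succ]
      -- The new index gives the conjugating letter, hence `t`; `t` determines its old index, and
      -- the two indices determine the Boolean.
      rintro ⟨⟨i, t⟩, c⟩ hq ⟨⟨i', t'⟩, c'⟩ hq' heq
      simp only [Finset.coe_product, Set.mem_prod, Finset.mem_coe] at hq hq'
      simp only [f, Prod.mk.injEq] at heq
      obtain ⟨h1, h2⟩ := heq
      rw [← h1] at h2
      have ht : t = t' := by simpa using h2
      subst ht
      have hi : i = i' := (hFp _ hq.1).1.unique (hFp _ hq'.1).1
      subst hi
      have hc : c = c' := by
        revert h1
        cases c <;> cases c' <;> fin_cases i <;> simp [next]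
      rw [hc]
    · intro q hq
      obtain ⟨q, hqm, rfl⟩ := Finset.mem_image.1 hq
      have hqF := hFp q.1 (Finset.mem_product.1 hqm).1
      refine ⟨hqF.1.conj (fun i => (hb i).rootForm_self) hbb hbs (hnext q) (hrb _), ?_⟩
      have h1 := cs.length_mul_le (r (next q) * q.1.2) (r (next q))⁻¹
      have h2 := cs.length_mul_le (r (next q)) q.1.2
      rw [length_inv] at h1
      have h3 := hN (next q)
      have h4 := hqF.2
      calc _ ≤ _ := h1
        _ ≤ N + N * (2 * k + 1) + N := by omega
        _ = _ := by ring

end PingPong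

end CoxeterSystem

/- `hinf` and `haff` follow from `hJinf`, `hJ` and irreducibility, and are not needed. -/
theorem proposition2p6 {B W : Type*} [Finite B] [Group W] {M : CoxeterMatrix B}
    (cs : CoxeterSystem M W) (hirr : M.IsIrreducible) (hinf : Infinite W)
    (haff : ¬ M.IsAffine) (hsl : M.IsSimplyLaced)
    (J : Set B) (hJ : J ≠ Set.univ) (hJinf : Infinite (cs.parabolic J)) :
    ∃ N : ℕ, ∀ k : ℕ,
      (2 ^ k : ℕ∞) ≤ Set.encard {t : W | cs.IsReflection t ∧ t ∉ cs.parabolic J ∧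
        cs.length t ≤ N * (2 * k + 1)} := by
  classical
  cases nonempty_fintype B
  obtain ⟨s, hs⟩ := (Set.ne_univ_iff_exists_notMem J).1 hJ
  obtain ⟨x, y, hx, hy, hx0, hy0, hxy, hJ0⟩ :=
    cs.exists_isRoot_pair_of_infinite_parabolic hsl hJinf
  obtain ⟨hxs, hys⟩ := hJ0 s hs
  have hz0 : 0 ≤ x + y := add_nonneg hx0 hy0
  obtain ⟨u, hu⟩ : ∃ u, 0 < x u := by
    by_contra! h
    have : x = 0 := le_antisymm h hx0
    simpa [this] using hx.rootForm_self
  obtain ⟨p⟩ := hirr.preconnected s u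
  obtain ⟨c, hc, hc0, hcz, hneg, hcs⟩ := cs.exists_isRoot_rootForm_neg hsl hz0 p
    (add_pos_of_pos_of_nonneg hu (hy0 u)) (by simp [hxs, hys])
  have hcx : M.rootForm c x ≤ -0 := by
    refine M.rootForm_nonpos hc0 hx0 fun i => (hcz i).imp id fun h => ?_
    have h1 : x i + y i = 0 := h
    have h2 : 0 ≤ x i := hx0 i
    have h3 : 0 ≤ y i := hy0 i
    omega
  have hcy : M.rootForm c y ≤ -0 := by
    refine M.rootForm_nonpos hc0 hy0 fun i => (hcz i).imp id fun h => ?_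
    have h1 : x i + y i = 0 := h
    have h2 : 0 ≤ x i := hx0 i
    have h3 : 0 ≤ y i := hy0 i
    omega
  rw [map_add] at hneg
  -- By integrality, each of the two rounds lowers the bound on the pairings with `c` by one, from
  -- `0` to `-2`.
  obtain ⟨x₁, y₁, hx₁, hy₁, hxy₁, hcx₁, hcy₁, hxs₁, hys₁⟩ :=
    hx.exists_pair_lt le_rfl hy hxy hcx hcy hneg hxs hys
  obtain ⟨x₂, y₂, hx₂, hy₂, hxy₂, hcx₂, hcy₂, hxs₂, hys₂⟩ :=
    hx₁.exists_pair_lt (c := c) (n := 1) (by norm_num) hy₁ hxy₁ (by omega) (by omega) (by omega) hxs₁ hys₁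
  have hb : ∀ i, cs.IsRoot hsl (![c, x₂, y₂] i) := by
    intro i; fin_cases i <;> assumption
  have hbb : ∀ i j, i ≠ j → M.rootForm (![c, x₂, y₂] i) (![c, x₂, y₂] j) ≤ -2 := by
    have h1 := M.rootForm_comm x₂ c
    have h2 := M.rootForm_comm y₂ c
    have h3 := M.rootForm_comm y₂ x₂
    intro i j hij
    fin_cases i <;> fin_cases j <;> simp at hij ⊢ <;> omega
  have hbs : ∀ i, 0 ≤ ![c, x₂, y₂] i s := by
    intro i
    fin_cases i
    · exact hc0 s
    · exact hxs₂.ge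
    · exact hys₂.ge
  obtain ⟨N, hN⟩ := CoxeterSystem.exists_finset_isPingPong hb hbb hbs hcs
  refine ⟨N, fun k => ?_⟩
  obtain ⟨F, hF, hFp⟩ := hN k
  have hcard : (F.image Prod.snd).card = 2 ^ k := by
    rw [Finset.card_image_of_injOn, hF]
    rintro ⟨i, t⟩ hq ⟨j, t'⟩ hq' (rfl : t = t')
    exact congrArg (·, t) ((hFp _ hq).1.unique (hFp _ hq').1)
  have hsub : (↑(F.image Prod.snd) : Set W) ⊆ {t : W | cs.IsReflection t ∧
      t ∉ cs.parabolic J ∧ cs.length t ≤ N * (2 * k + 1)} := by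
    intro t ht
    obtain ⟨q, hq, rfl⟩ := Finset.mem_image.1 ht
    obtain ⟨⟨hrefl, v, hv, hv2, hvs, -⟩, hlen⟩ := hFp q hq
    refine ⟨hrefl, fun hmem => ?_, hlen⟩
    -- `W_J` fixes `s`-coordinates, whereas `t` negates `v`, whose `s`-coordinate is positive.
    have := cs.geomRep_apply_of_mem_parabolic hsl hmem hs v
    rw [hv, M.refl_self hv2, Pi.neg_apply] at this
    omega
  refine le_trans ?_ (Set.encard_le_encard hsub)
  rw [Set.encard_coe_eq_coe_finsetCard, hcard]
  simp
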